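/- Let $G$ be a finite simple graph with $n$ vertices, $m$ edges and chromatic number $k$, and let $\pi(G,z)$ be its chromatic polynomial, i.e. the polynomial whose value at every integer $x\ge 0$ is the number of proper colourings of $G$ with $x$ colours. Then every complex root of $\pi(G,z)$ lies in $\{0,1,\dots,k-1\}\cup\mathcal U$, where $\mathcal U$ is the union of the closed discs in $\mathbb C$ centred at $$k,\ k+1,\ \dots,\ n-2,\quad\text{and}\quad n-1-\binom n2+m,$$ each of radius $\sqrt2\left(\binom n2-m\right)$ (there are no centres $k,\dots,n-2$ if $k>n-2$). Moreover, every complex root $z$ of $\pi(G,z)$ satisfies $$|z|\le n-1+\sqrt2\left(\binom n2-m\right).$$ -/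

import Mathlib

namespace SimpleGraph

/-- There is an integer polynomial whose value at every natural number `x` is the number of
proper colourings of the finite graph `G` with the colours `Fin x`. -/
theorem exists_chromaticPolynomial {V : Type*} [Finite V] (G : SimpleGraph V) :
    ∃ p : Polynomial ℤ, ∀ x : ℕ, p.eval (x : ℤ) = (Nat.card (G.Coloring (Fin x)) : ℤ) := by
  classical
  have := Fintype.ofFinite V
  let S := {s : Setoid V // ∀ u v, G.Adj u v → ¬ s u v}
  have hS : Finite S := by
    have : Finite (Setoid V) := Finite.of_injective (fun s : Setoid V => fun u v => s u v)
      (fun s t h => Setoid.ext fun u v => by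
        have := congrFun (congrFun h u) v
        simpa using this)
    exact inferInstance
  have := Fintype.ofFinite S
  refine ⟨∑ s : S, descPochhammer ℤ (Nat.card (Quotient s.1)), fun x => ?_⟩
  let F : (Σ s : S, (Quotient s.1 ↪ Fin x)) → G.Coloring (Fin x) := fun q =>
    Coloring.mk (fun v => q.2 (Quotient.mk q.1.1 v)) (by
      intro u v h h'
      exact q.1.2 u v h (Quotient.exact (q.2.injective h')))
  have hF : Function.Bijective F := by
    constructor
    · rintro ⟨⟨s, hs⟩, g⟩ ⟨⟨t, ht⟩, g'⟩ h
      have h1 : ∀ v, g (Quotient.mk s v) = g' (Quotient.mk t v) := fun v => DFunLike.congr_fun h v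
      have hst : s = t := by
        ext u v
        constructor
        · intro huv
          refine Quotient.exact (g'.injective ?_)
          rw [← h1, ← h1, Quotient.sound huv]
        · intro huv
          refine Quotient.exact (g.injective ?_)
          rw [h1, h1, Quotient.sound huv]
      subst hst
      have hg : g = g' := by
        ext q
        induction q using Quotient.inductionOn with
        | h v => rw [h1 v]
      rw [hg]
    · intro f
      exact ⟨⟨⟨Setoid.ker f, fun u v h h' => f.valid h h'⟩,
        ⟨Quotient.lift f (fun _ _ h => h), by
          rintro ⟨a⟩ ⟨b⟩ h
          exact Quotient.sound h⟩⟩, rfl⟩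
  rw [← Nat.card_congr (Equiv.ofBijective F hF), Nat.card_sigma, Polynomial.eval_finsetSum]
  push_cast
  refine Finset.sum_congr rfl fun s _ => ?_
  have := Fintype.ofFinite (Quotient s.1)
  rw [descPochhammer_eval_eq_descFactorial, Nat.card_eq_fintype_card, Nat.card_eq_fintype_card,
    Fintype.card_embedding_eq, Fintype.card_fin]

/-- The chromatic polynomial of a finite graph `G`: the polynomial whose value at every natural
number `x` is the number of proper `x`-colourings of `G`. -/
noncomputable def chromaticPolynomial {V : Type*} [Finite V] (G : SimpleGraph V) :
    Polynomial ℤ :=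
  Classical.choose G.exists_chromaticPolynomial

theorem eval_chromaticPolynomial {V : Type*} [Finite V] (G : SimpleGraph V) (x : ℕ) :
    G.chromaticPolynomial.eval (x : ℤ) = (Nat.card (G.Coloring (Fin x)) : ℤ) :=
  Classical.choose_spec G.exists_chromaticPolynomial x

/-- The chromatic polynomial is determined by its values at the natural numbers. -/
theorem eq_chromaticPolynomial {V : Type*} [Finite V] (G : SimpleGraph V) (p : Polynomial ℤ)
    (hp : ∀ x : ℕ, p.eval (x : ℤ) = (Nat.card (G.Coloring (Fin x)) : ℤ)) :
    p = G.chromaticPolynomial := by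
  refine Polynomial.eq_of_infinite_eval_eq _ _ ?_
  refine (Set.infinite_range_of_injective (Nat.cast_injective (R := ℤ))).mono ?_
  rintro _ ⟨x, rfl⟩
  exact (hp x).trans (G.eval_chromaticPolynomial x).symm

/-- The chromatic roots of `G`: the complex roots of its chromatic polynomial. -/
def chromaticRoots {V : Type*} [Finite V] (G : SimpleGraph V) : Set ℂ :=
  {z : ℂ | Polynomial.aeval z G.chromaticPolynomial = 0}

end SimpleGraph

/-!
Let `N` be the number of non-adjacent pairs of vertices, and let `a t` be the number of partitions
of the `n` vertices into `n - t` independent sets. Then the chromatic polynomial is the sum of the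
`a t * z (z - 1) ⋯ (z - (n - t) + 1)`, where `a 0 = 1`, `a 1 = N`, and `a t = 0` if `n - t` is
below the chromatic number `k`.

The combinatorial input is the bound `a t ≤ N.choose t` (`stableCount_le_choose`). A partition is
recovered from any spanning forest of its classes; taking in each class the star at a chosen vertex
embeds the partitions into `n - t` independent sets into the `t`-element sets of edges of the
complement of `G`.

The rest is a dominance argument with `r = √2 * N`, resting on
`∑ (N.choose t) / r ^ t ≤ ∑ (1 / √2) ^ t / t!`.

* Location of the roots (`norm_sub_le_of_sum_falling_eq_zero`): outside the discs about
  `k, …, n - 2` each further factor of a falling factorial has absolute value more than `r`. Divide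
  a zero sum by the falling factorial of length `n - 1`: the first two terms become
  `z - (n - 1 - N)`, and the others add up to at most
  `r * ∑_{t ≥ 2} (1 / √2) ^ t / t!`, which is at most `r`.
* Absolute value (`norm_le_of_sum_falling_eq_zero`): the last disc alone does not give the bound
  when `N` is large compared with `n`. If `|z| > n - 1 + r`, then `z` is at distance more than `r`
  from all of `0, …, n - 1`. Divide by the falling factorial of length `n`. With
  `u = N / (z - n + 1)`, the terms `t = 0, 1, 2` become `1 + u + b * u ^ 2` with `0 ≤ b ≤ 1 / 2`, up
  to a small error; the real part of this is at least `1 - 1 / √2`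
  (`le_norm_one_add_add_mul_sq`), more than the error and the terms with `t ≥ 3` together.
  Separating off only `t = 0` would not do, since `exp (1 / √2) - 1 > 1`.
-/

namespace SimpleGraph

/-! ### Star forests of a partition -/

section StarForests

variable {V : Type*} [Fintype V] [DecidableEq V]

/-- The edges joining each point to the chosen representative of its class under `s`. They form
a spanning forest of stars, with one star for each class. -/
noncomputable def starEdges (s : Setoid V) : Finset (Sym2 V) :=
  (Finset.univ.filter fun v => (Quotient.mk s v).out ≠ v).image
    fun v => s(v, (Quotient.mk s v).out)

theorem mk_out_mem_starEdges (s : Setoid V) {v : V} (hv : (Quotient.mk s v).out ≠ v) :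
    s(v, (Quotient.mk s v).out) ∈ starEdges s :=
  Finset.mem_image_of_mem _ (by simpa using hv)

theorem rel_and_ne_of_mk_mem_starEdges (s : Setoid V) {u v : V} (h : s(u, v) ∈ starEdges s) :
    s u v ∧ u ≠ v := by
  obtain ⟨w, hw, he⟩ := Finset.mem_image.1 h
  have hw' : (Quotient.mk s w).out ≠ w := by simpa using hw
  have hr : s (Quotient.mk s w).out w := Quotient.mk_out w
  rcases Sym2.eq_iff.1 he with ⟨rfl, rfl⟩ | ⟨rfl, rfl⟩
  · exact ⟨s.symm hr, hw'.symm⟩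
  · exact ⟨hr, hw'⟩

theorem card_starEdges (s : Setoid V) :
    Nat.card (Quotient s) + (starEdges s).card = Fintype.card V := by
  have hinj : Set.InjOn (fun v => s(v, (Quotient.mk s v).out))
      (Finset.univ.filter fun v => (Quotient.mk s v).out ≠ v : Finset V) := by
    intro u hu v hv h
    rcases Sym2.eq_iff.1 h with ⟨h1, -⟩ | ⟨h1, h2⟩
    · exact h1
    · refine absurd ?_ (show (Quotient.mk s u).out ≠ u by simpa using hu)
      have : Quotient.mk s u = Quotient.mk s v := by
        rw [h1, Quotient.out_eq]
      rw [this]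
      exact h1.symm
  have hrep : (Finset.univ.filter fun v => (Quotient.mk s v).out = v).card =
      Nat.card (Quotient s) := by
    have := Fintype.ofFinite (Quotient s)
    rw [Nat.card_eq_fintype_card, ← Finset.card_univ,
      ← Finset.card_image_of_injective Finset.univ (Quotient.out_injective (s := s))]
    congr 1
    ext v
    simp only [Finset.mem_filter, Finset.mem_univ, true_and, Finset.mem_image]
    refine ⟨fun h => ⟨_, h⟩, ?_⟩
    rintro ⟨q, rfl⟩
    rw [Quotient.out_eq]
  rw [starEdges, Finset.card_image_of_injOn hinj, ← hrep,
    Finset.card_filter_add_card_filter_not, Finset.card_univ]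

theorem le_of_starEdges_subset {s t : Setoid V} (h : starEdges s ⊆ starEdges t) : s ≤ t := by
  have key : ∀ v, t v (Quotient.mk s v).out := fun v => by
    by_cases hv : (Quotient.mk s v).out = v
    · rw [hv]
    · exact (rel_and_ne_of_mk_mem_starEdges t (h (mk_out_mem_starEdges s hv))).1
  intro u v huv
  have hu := key u
  rw [Quotient.sound (s := s) huv] at hu
  exact t.trans hu (t.symm (key v))

theorem starEdges_injective : Function.Injective (starEdges : Setoid V → Finset (Sym2 V)) :=
  fun _ _ h => le_antisymm (le_of_starEdges_subset h.subset) (le_of_starEdges_subset h.symm.subset)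

end StarForests

/-! ### Partitions into independent sets and the chromatic polynomial -/

section StablePartitions

variable {V : Type*} [Fintype V] (G : SimpleGraph V)

instance finite_setoid : Finite (Setoid V) := by
  classical
  exact Finite.of_injective _ (starEdges_injective (V := V))

/-- The partitions of the vertices into independent sets, encoded as equivalence relations. -/
def stableSetoids : Set (Setoid V) := {s | ∀ u v, G.Adj u v → ¬ s u v}

/-- The number of partitions of the `n` vertices into exactly `n - t` independent sets
(zero if `t > n`). -/
noncomputable def stableCount (t : ℕ) : ℕ :=
  {s ∈ G.stableSetoids | Nat.card (Quotient s) + t = Fintype.card V}.ncard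

theorem chromaticPolynomial_eq_sum_stableCount :
    G.chromaticPolynomial = ∑ t ∈ Finset.range (Fintype.card V + 1),
      (G.stableCount t : Polynomial ℤ) * descPochhammer ℤ (Fintype.card V - t) := by
  classical
  refine (G.eq_chromaticPolynomial _ fun x => ?_).symm
  -- A colouring amounts to its kernel together with an injection of the classes into the colours.
  let F : (Σ s : G.stableSetoids, (Quotient s.1 ↪ Fin x)) → G.Coloring (Fin x) := fun q =>
    Coloring.mk (fun v => q.2 (Quotient.mk q.1.1 v)) fun {u v} h h' =>
      q.1.2 u v h (Quotient.exact (q.2.injective h'))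
  have hF : Function.Bijective F := by
    constructor
    · rintro ⟨⟨s, hs⟩, g⟩ ⟨⟨t, ht⟩, g'⟩ h
      have h1 : ∀ v, g (Quotient.mk s v) = g' (Quotient.mk t v) := fun v => DFunLike.congr_fun h v
      have hst : s = t := by
        ext u v
        constructor
        · intro huv
          refine Quotient.exact (g'.injective ?_)
          rw [← h1, ← h1, Quotient.sound huv]
        · intro huv
          refine Quotient.exact (g.injective ?_)
          rw [h1, h1, Quotient.sound huv]
      subst hst
      have hg : g = g' := by
        ext q
        induction q using Quotient.inductionOn with
        | h v => rw [h1 v]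
      rw [hg]
    · intro f
      exact ⟨⟨⟨Setoid.ker f, fun u v h h' => f.valid h h'⟩,
        ⟨Quotient.lift f (fun _ _ h => h), by
          rintro ⟨a⟩ ⟨b⟩ h
          exact Quotient.sound h⟩⟩, rfl⟩
  have := Fintype.ofFinite G.stableSetoids
  rw [← Nat.card_congr (Equiv.ofBijective F hF), Nat.card_sigma, Polynomial.eval_finsetSum]
  have hemb : ∀ s : G.stableSetoids, Nat.card (Quotient s.1 ↪ Fin x) =
      x.descFactorial (Nat.card (Quotient s.1)) := fun s => by
    have := Fintype.ofFinite (Quotient s.1)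
    rw [Nat.card_eq_fintype_card, Nat.card_eq_fintype_card, Fintype.card_embedding_eq,
      Fintype.card_fin]
  simp only [hemb, Polynomial.eval_mul, Polynomial.eval_natCast,
    descPochhammer_eval_eq_descFactorial]
  norm_cast
  have hmaps : ∀ s ∈ (Finset.univ : Finset G.stableSetoids),
      (starEdges s.1).card ∈ Finset.range (Fintype.card V + 1) := fun s _ => by
    have := card_starEdges s.1
    simp only [Finset.mem_range]
    omega
  rw [← Finset.sum_fiberwise_of_maps_to hmaps]
  refine Finset.sum_congr rfl fun t ht => ?_
  rw [Finset.sum_congr rfl (g := fun _ => x.descFactorial (Fintype.card V - t)), Finset.sum_const,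
    smul_eq_mul]
  · congr 1
    rw [stableCount, ← Set.ncard_coe_finset, ← Set.ncard_image_of_injective _ Subtype.val_injective]
    congr 1
    ext s
    have := card_starEdges s
    simp only [Set.mem_ofPred_eq, Set.mem_image, Finset.coe_filter, Finset.mem_univ, true_and,
      Subtype.exists, exists_and_right, exists_eq_right]
    constructor
    · rintro ⟨h1, h2⟩
      exact ⟨h1, by omega⟩
    · rintro ⟨h1, h2⟩
      exact ⟨h1, by omega⟩
  · intro s hs
    have := card_starEdges s.1
    rw [Finset.mem_filter] at hs
    congr 1
    omega

theorem starEdges_subset_compl [DecidableEq V] {s : Setoid V} (hs : s ∈ G.stableSetoids) :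
    (starEdges s : Set (Sym2 V)) ⊆ Gᶜ.edgeSet := by
  intro e
  induction e using Sym2.ind with
  | _ u v =>
    intro he
    obtain ⟨h1, h2⟩ := rel_and_ne_of_mk_mem_starEdges s he
    exact (G.compl_adj u v).2 ⟨h2, fun h => hs u v h h1⟩

theorem stableCount_le_choose (t : ℕ) : G.stableCount t ≤ Gᶜ.edgeSet.ncard.choose t := by
  classical
  rw [Set.ncard_eq_toFinset_card' Gᶜ.edgeSet, ← Finset.card_powersetCard,
    ← Set.ncard_coe_finset, stableCount]
  refine Set.ncard_le_ncard_of_injOn starEdges ?_ starEdges_injective.injOn (Finset.finite_toSet _)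
  rintro s ⟨hs, ht⟩
  have := card_starEdges s
  rw [Finset.mem_coe, Finset.mem_powersetCard]
  refine ⟨fun e he => ?_, by omega⟩
  simpa using G.starEdges_subset_compl hs he

theorem stableCount_zero : G.stableCount 0 = 1 := by
  classical
  refine le_antisymm ((G.stableCount_le_choose 0).trans (by simp)) ?_
  rw [Nat.one_le_iff_ne_zero, stableCount, Ne, Set.ncard_eq_zero, ← Ne,
    ← Set.nonempty_iff_ne_empty]
  refine ⟨⊥, fun u v h h' => h.ne h', ?_⟩
  have h0 : starEdges (⊥ : Setoid V) = ∅ := by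
    refine Finset.eq_empty_of_forall_notMem fun e => ?_
    induction e using Sym2.ind with
    | _ u v =>
      intro he
      obtain ⟨h1, h2⟩ := rel_and_ne_of_mk_mem_starEdges _ he
      exact h2 h1
  have := card_starEdges (⊥ : Setoid V)
  rw [h0, Finset.card_empty] at this
  exact this

theorem stableCount_one : G.stableCount 1 = Gᶜ.edgeSet.ncard := by
  classical
  refine le_antisymm ((G.stableCount_le_choose 1).trans (by simp)) ?_
  rw [stableCount, ← Set.ncard_image_of_injective _ (starEdges_injective (V := V)),
    ← Set.ncard_image_of_injective _ (Finset.singleton_injective (α := Sym2 V))]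
  refine Set.ncard_le_ncard ?_
  rintro _ ⟨e, he, rfl⟩
  induction e using Sym2.ind with
  | _ a b =>
    rw [mem_edgeSet, compl_adj] at he
    -- The partition whose only class with more than one vertex is `{a, b}`.
    let s : Setoid V := Setoid.ker fun w => if w = a then b else w
    have hs : ∀ u v, s u v → u ≠ v → s(u, v) = s(a, b) := fun u v h huv => by
      have h' : (if u = a then b else u) = if v = a then b else v := h
      rw [Sym2.eq_iff]
      split_ifs at h' with h1 h2 h2
      · exact absurd (h1.trans h2.symm) huv
      · exact Or.inl ⟨h1, h'.symm⟩
      · exact Or.inr ⟨h', h2⟩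
      · exact absurd h' huv
    have hE : starEdges s = {s(a, b)} := by
      refine Finset.eq_singleton_iff_nonempty_unique_mem.2 ⟨?_, fun e => ?_⟩
      · by_contra hne
        rw [Finset.not_nonempty_iff_eq_empty] at hne
        have hle : s ≤ ⊥ := le_of_starEdges_subset (by simp [hne])
        have hab : s a b := by
          change (if a = a then b else a) = if b = a then b else b
          simp
        exact he.1 (hle hab)
      · induction e using Sym2.ind with
        | _ u v =>
          intro hm
          obtain ⟨h1, h2⟩ := rel_and_ne_of_mk_mem_starEdges _ hm
          exact hs u v h1 h2
    refine ⟨s, ⟨fun u v h h' => ?_, ?_⟩, hE⟩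
    · have h1 : s(u, v) ∈ G.edgeSet := h
      rw [hs u v h' h.ne] at h1
      exact he.2 h1
    · have := card_starEdges s
      rwa [hE, Finset.card_singleton] at this

theorem chromaticNumber_le_of_stableCount_ne_zero {t : ℕ} (h : G.stableCount t ≠ 0) :
    G.chromaticNumber + t ≤ Fintype.card V := by
  rw [stableCount, Ne, Set.ncard_eq_zero, ← Ne, ← Set.nonempty_iff_ne_empty] at h
  obtain ⟨s, hs, ht⟩ := h
  have := Fintype.ofFinite (Quotient s)
  have hc : G.Colorable (Nat.card (Quotient s)) := by
    rw [Nat.card_eq_fintype_card]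
    exact (Coloring.mk (Quotient.mk s) fun {u v} h h' => hs u v h (Quotient.exact h')).colorable
  rw [← ht]
  push_cast
  gcongr
  exact hc.chromaticNumber_le

theorem ncard_edgeSet_add_ncard_edgeSet_compl :
    G.edgeSet.ncard + Gᶜ.edgeSet.ncard = (Fintype.card V).choose 2 := by
  classical
  rw [← card_edgeFinset_top_eq_card_choose_two, ← Set.ncard_coe_finset, coe_edgeFinset,
    ← sup_compl_eq_top (x := G), edgeSet_sup, Set.ncard_union_eq]
  rw [disjoint_edgeSet]
  exact disjoint_compl_right

end StablePartitions

/-! ### Zeros of expansions in falling factorials -/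

section FallingFactorialExpansions

theorem norm_prod_range_sub_mul_pow_le {z : ℂ} {r : ℝ} (hr : 0 ≤ r) {j l : ℕ} (hjl : j ≤ l)
    (h : ∀ i, j ≤ i → i < l → r ≤ ‖z - (i : ℂ)‖) :
    ‖∏ i ∈ Finset.range j, (z - (i : ℂ))‖ * r ^ (l - j) ≤
      ‖∏ i ∈ Finset.range l, (z - (i : ℂ))‖ := by
  rw [← Finset.prod_range_mul_prod_Ico _ hjl, norm_mul]
  refine mul_le_mul_of_nonneg_left ?_ (norm_nonneg _)
  rw [← Nat.card_Ico, norm_prod, ← Finset.prod_const]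
  refine Finset.prod_le_prod (fun _ _ => hr) fun i hi => ?_
  rw [Finset.mem_Ico] at hi
  exact h i hi.1 hi.2

theorem sum_Ico_pow_div_factorial_le {x : ℝ} (h0 : 0 ≤ x) (h1 : x ≤ 1) {c : ℕ} (hc : 0 < c)
    (d : ℕ) :
    ∑ t ∈ Finset.Ico c d, x ^ t / (t.factorial : ℝ) ≤
      x ^ c * (c + 1) / (c.factorial * c : ℝ) := by
  rcases le_total c d with hcd | hcd
  · rw [Finset.sum_Ico_eq_sub _ hcd]
    linarith [Real.sum_le_exp_of_nonneg h0 d, Real.exp_bound' h0 h1 hc]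
  · rw [Finset.Ico_eq_empty_of_le hcd, Finset.sum_empty]
    positivity

theorem sum_Ico_choose_div_pow_le {N : ℕ} (hN : 0 < N) {c : ℕ} (hc : 0 < c) (d : ℕ) :
    ∑ t ∈ Finset.Ico c d, (N.choose t : ℝ) / (√2 * N) ^ t ≤
      (√2)⁻¹ ^ c * (c + 1) / (c.factorial * c : ℝ) := by
  have hN' : (0 : ℝ) < N := Nat.cast_pos.2 hN
  have h2 : (1 : ℝ) ≤ √2 := Real.one_le_sqrt.2 one_le_two
  refine le_trans (Finset.sum_le_sum fun t _ => ?_)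
    (sum_Ico_pow_div_factorial_le (x := (√2)⁻¹) (by positivity) (inv_le_one_of_one_le₀ h2) hc d)
  calc (N.choose t : ℝ) / (√2 * N) ^ t ≤ ((N : ℝ) ^ t / t.factorial) / (√2 * N) ^ t := by
        gcongr
        exact Nat.choose_le_pow_div t N
    _ = (√2)⁻¹ ^ t / t.factorial := by
        rw [mul_pow, inv_pow]
        field_simp

/-- The estimate for the tail of an expansion in falling factorials, used with `f t` the
falling factorial of length `n - t`; the constant is the error bound in the Taylor expansion of
`exp (√2)⁻¹`. Where `a t = 0`, nothing is asked of `f t`. -/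
theorem norm_sum_Ico_mul_le {N : ℕ} (hN : 0 < N) {a : ℕ → ℕ} (ha : ∀ t, a t ≤ N.choose t)
    {f : ℕ → ℂ} {B : ℝ} (hB : 0 ≤ B) {c : ℕ} (hc : 0 < c) (d : ℕ)
    (hf : ∀ t ∈ Finset.Ico c d, a t ≠ 0 → ‖f t‖ * (√2 * N) ^ t ≤ B) :
    ‖∑ t ∈ Finset.Ico c d, (a t : ℂ) * f t‖ ≤
      (√2)⁻¹ ^ c * (c + 1) / (c.factorial * c : ℝ) * B := by
  have hN' : (0 : ℝ) < N := Nat.cast_pos.2 hN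
  refine (norm_sum_le _ _).trans ?_
  refine le_trans ?_ (mul_le_mul_of_nonneg_right (sum_Ico_choose_div_pow_le hN hc d) hB)
  rw [Finset.sum_mul]
  refine Finset.sum_le_sum fun t ht => ?_
  rw [norm_mul, Complex.norm_natCast]
  rcases eq_or_ne (a t) 0 with h0 | h0
  · rw [h0, Nat.cast_zero, zero_mul]
    positivity
  · have hat : (a t : ℝ) ≤ N.choose t := Nat.cast_le.2 (ha t)
    rw [div_mul_eq_mul_div, mul_div_assoc]
    refine mul_le_mul hat ?_ (norm_nonneg _) (by positivity)
    rw [le_div_iff₀ (by positivity)]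
    exact hf t ht h0

/-- A root of an expansion in falling factorials that avoids the integers below `k` and the discs
about the integers from `k` to `n - 2` lies in the disc about `n - 1 - N`. -/
theorem norm_sub_le_of_sum_falling_eq_zero {k n N : ℕ} {a : ℕ → ℕ} {z : ℂ} (ha0 : a 0 = 1)
    (ha1 : a 1 = N) (ha : ∀ t, a t ≤ N.choose t) (hak : ∀ t, a t ≠ 0 → k + t ≤ n) (hn : 0 < n)
    (hz : ∀ i : ℕ, i < k → z ≠ i) (hz' : ∀ i : ℕ, k ≤ i → i + 2 ≤ n → √2 * N < ‖z - i‖)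
    (h : ∑ t ∈ Finset.range (n + 1), (a t : ℂ) * ∏ i ∈ Finset.range (n - t), (z - i) = 0) :
    ‖z - (n - 1 - N)‖ ≤ √2 * N := by
  obtain ⟨l, rfl⟩ : ∃ l, n = l + 1 := ⟨n - 1, by omega⟩
  have hP : ∏ i ∈ Finset.range l, (z - (i : ℂ)) ≠ 0 := by
    refine Finset.prod_ne_zero_iff.2 fun i hi => ?_
    rw [Finset.mem_range] at hi
    rcases lt_or_ge i k with hik | hik
    · exact sub_ne_zero.2 (hz i hik)
    · exact norm_pos_iff.1 (lt_of_le_of_lt (by positivity) (hz' i hik (by omega)))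
  -- The terms `t = 0` and `t = 1` combine into one linear factor times the product of length `l`.
  have hsum : (z - (((l + 1 : ℕ) : ℂ) - 1 - N)) * ∏ i ∈ Finset.range l, (z - (i : ℂ)) =
      -∑ t ∈ Finset.Ico 2 (l + 1 + 1),
        (a t : ℂ) * ∏ i ∈ Finset.range (l + 1 - t), (z - (i : ℂ)) := by
    rw [← Finset.sum_range_add_sum_Ico _ (show 2 ≤ l + 1 + 1 by omega), Finset.sum_range_succ,
      Finset.sum_range_one, ha0, ha1] at h
    rw [Nat.sub_zero, Nat.add_sub_cancel, Finset.prod_range_succ] at h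
    push_cast at h ⊢
    linear_combination h
  have hPpos := norm_pos_iff.2 hP
  refine le_of_mul_le_mul_right ?_ hPpos
  rw [← norm_mul, hsum, norm_neg]
  rcases Nat.eq_zero_or_pos N with rfl | hN
  · rw [Finset.sum_eq_zero fun t ht => ?_]
    · simp
    · have h2 : 2 ≤ t := (Finset.mem_Ico.1 ht).1
      have : a t = 0 := by
        have := ha t
        rwa [Nat.choose_eq_zero_of_lt (by omega), Nat.le_zero] at this
      rw [this, Nat.cast_zero, zero_mul]
  · have hN' : (0 : ℝ) < N := Nat.cast_pos.2 hN
    refine (norm_sum_Ico_mul_le hN ha (B := √2 * N * ‖∏ i ∈ Finset.range l, (z - (i : ℂ))‖)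
      (by positivity) two_pos _ fun t ht hat => ?_).trans ?_
    · have hkt := hak t hat
      have ht2 : 2 ≤ t := (Finset.mem_Ico.1 ht).1
      have hle := norm_prod_range_sub_mul_pow_le (z := z) (r := √2 * N) (by positivity)
        (show l + 1 - t ≤ l by omega) fun i h1 h2 => (hz' i (by omega) (by omega)).le
      have ht' : t = l - (l + 1 - t) + 1 := by omega
      conv_lhs => rw [ht', pow_succ]
      rw [← ht']
      nlinarith [mul_le_mul_of_nonneg_left hle (show 0 ≤ √2 * (N : ℝ) by positivity)]
    · refine mul_le_of_le_one_left (by positivity) ?_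
      rw [inv_pow, Real.sq_sqrt zero_le_two]
      norm_num [Nat.factorial]

/-- Already the real part is at least `1 - 1 / √2`. -/
theorem le_norm_one_add_add_mul_sq {u : ℂ} (hu : ‖u‖ ≤ (√2)⁻¹) {b : ℝ} (hb0 : 0 ≤ b)
    (hb : b ≤ 1 / 2) : 1 - (√2)⁻¹ ≤ ‖1 + u + b * u ^ 2‖ := by
  refine le_trans ?_ (Complex.re_le_norm _)
  have hsq : (√2)⁻¹ ^ 2 = (1 / 2 : ℝ) := by
    rw [inv_pow, Real.sq_sqrt zero_le_two, one_div]
  have h1 : u.re ^ 2 + u.im ^ 2 ≤ 1 / 2 := by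
    have := pow_le_pow_left₀ (norm_nonneg u) hu 2
    rw [hsq, Complex.sq_norm, Complex.normSq_apply] at this
    linarith
  have h2 : -(√2)⁻¹ ≤ u.re := (neg_le_neg hu).trans (abs_le.1 (Complex.abs_re_le_norm u)).1
  have h3 : (1 / 2 : ℝ) ≤ (√2)⁻¹ := by
    rw [← pow_le_pow_iff_left₀ (by norm_num) (by positivity) two_ne_zero, hsq]
    norm_num
  have hre : (1 + u + b * u ^ 2).re = 1 + u.re + b * (u.re ^ 2 - u.im ^ 2) := by
    simp [pow_two]
  rw [hre]
  -- The right side is affine in `b`, so the cases `b = 0` and `b = 1 / 2` are enough.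
  have e0 : 1 - (√2)⁻¹ ≤ 1 + u.re := by linarith
  have e1 : 1 - (√2)⁻¹ ≤ 1 + u.re + 1 / 2 * (u.re ^ 2 - u.im ^ 2) := by
    nlinarith [sq_nonneg (u.re + 1 / 2)]
  nlinarith [mul_le_mul_of_nonneg_left e0 (show 0 ≤ 1 - 2 * b by linarith),
    mul_le_mul_of_nonneg_left e1 (show 0 ≤ 2 * b by linarith)]

/-- In the expansion of the chromatic polynomial at `z = w + n - 1`, divided by the falling
factorial of length `n - 2`, the terms with the falling factorials of lengths `n`, `n - 1` and
`n - 2` exceed the bound that `norm_sum_Ico_mul_le` gives for all the others. -/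
theorem lt_norm_leading_terms {N : ℕ} (hN : 0 < N) {a : ℕ} (ha : a ≤ N.choose 2) {w : ℂ}
    (hw : √2 * N < ‖w‖) (hw1 : √2 * N < ‖w + 1‖) :
    (√2)⁻¹ ^ 3 * (2 / 9) * ‖(w + 1) * w‖ < ‖(w + 1) * w + N * (w + 1) + a‖ := by
  have hN' : (1 : ℝ) ≤ N := Nat.one_le_cast.2 hN
  have h2 : (0 : ℝ) < √2 := by positivity
  have hsq : √2 ^ 2 = (2 : ℝ) := Real.sq_sqrt zero_le_two
  have hwpos : 0 < ‖w‖ := lt_of_le_of_lt (by positivity) hw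
  have hw1pos : 0 < ‖w + 1‖ := lt_of_le_of_lt (by positivity) hw1
  have hw0 : w ≠ 0 := norm_pos_iff.1 hwpos
  have hw10 : w + 1 ≠ 0 := norm_pos_iff.1 hw1pos
  have hNC : (N : ℂ) ≠ 0 := by exact_mod_cast hN.ne'
  obtain ⟨b, hb⟩ : ∃ b : ℝ, b = (a : ℝ) / (N : ℝ) ^ 2 := ⟨_, rfl⟩
  have hb0 : 0 ≤ b := by rw [hb]; positivity
  have hb1 : b ≤ 1 / 2 := by
    have h1 : (a : ℝ) ≤ (N : ℝ) ^ 2 / 2 :=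
      (Nat.cast_le.2 ha).trans (by simpa using Nat.choose_le_pow_div (α := ℝ) 2 N)
    rw [hb, div_le_iff₀ (by positivity)]
    linarith
  have hu : ‖(N : ℂ) / w‖ ≤ (√2)⁻¹ := by
    rw [norm_div, Complex.norm_natCast, div_le_iff₀ hwpos, inv_mul_eq_div, le_div_iff₀ h2]
    linarith
  have hmain := le_norm_one_add_add_mul_sq hu hb0 hb1
  -- Replacing `w ^ 2` by `w * (w + 1)` in the quadratic term costs little.
  have herr : ‖(b : ℂ) * (N / w) ^ 2 / (w + 1)‖ ≤ 1 / 4 * (√2)⁻¹ := by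
    rw [norm_div, norm_mul, norm_pow, Complex.norm_real, Real.norm_of_nonneg hb0,
      div_le_iff₀ hw1pos]
    have h3 : ‖(N : ℂ) / w‖ ^ 2 ≤ 1 / 2 := by
      have := pow_le_pow_left₀ (norm_nonneg _) hu 2
      rwa [inv_pow, hsq, ← one_div] at this
    have h4 : √2 ≤ ‖w + 1‖ := by nlinarith
    calc b * ‖(N : ℂ) / w‖ ^ 2 ≤ 1 / 2 * (1 / 2) := by gcongr
      _ = 1 / 4 * (√2)⁻¹ * √2 := by field_simp; norm_num
      _ ≤ 1 / 4 * (√2)⁻¹ * ‖w + 1‖ := by gcongr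
  have hid : (w + 1) * w + N * (w + 1) + a =
      (1 + N / w + b * (N / w) ^ 2 - b * (N / w) ^ 2 / (w + 1)) * ((w + 1) * w) := by
    have hba : (b : ℂ) = a / (N : ℂ) ^ 2 := by rw [hb]; push_cast; rfl
    rw [hba]
    field_simp
    ring
  rw [hid, norm_mul _ ((w + 1) * w)]
  refine mul_lt_mul_of_pos_right ?_ (norm_pos_iff.2 (mul_ne_zero hw10 hw0))
  refine lt_of_lt_of_le ?_ (norm_sub_norm_le _ _)
  refine lt_of_lt_of_le ?_ (sub_le_sub hmain herr)
  have h3 : (√2)⁻¹ ^ 3 = 1 / 2 * (√2)⁻¹ := by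
    rw [pow_succ, inv_pow, hsq, one_div]
  have h4 : (√2)⁻¹ < 5 / 7 := by
    rw [inv_lt_comm₀ h2 (by norm_num)]
    exact Real.lt_sqrt_of_sq_lt (by norm_num)
  rw [h3]
  linarith

theorem norm_le_of_sum_falling_eq_zero {n N : ℕ} {a : ℕ → ℕ} {z : ℂ} (ha0 : a 0 = 1)
    (ha1 : a 1 = N) (ha : ∀ t, a t ≤ N.choose t) (hN : N ≤ n.choose 2)
    (h : ∑ t ∈ Finset.range (n + 1), (a t : ℂ) * ∏ i ∈ Finset.range (n - t), (z - i) = 0) :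
    ‖z‖ ≤ n - 1 + √2 * N := by
  by_contra! hz
  have hfar : ∀ i < n, √2 * N < ‖z - (i : ℂ)‖ := fun i hi => by
    have h1 := norm_sub_norm_le z (i : ℂ)
    have h2 : (i : ℝ) + 1 ≤ n := by exact_mod_cast hi
    rw [Complex.norm_natCast] at h1
    linarith
  have hP : ∏ i ∈ Finset.range n, (z - (i : ℂ)) ≠ 0 :=
    Finset.prod_ne_zero_iff.2 fun i hi =>
      norm_pos_iff.1 (lt_of_le_of_lt (by positivity) (hfar i (Finset.mem_range.1 hi)))
  rcases Nat.eq_zero_or_pos N with rfl | hNpos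
  · rw [Finset.sum_range_succ', Finset.sum_eq_zero fun t _ => ?_, ha0, Nat.sub_zero, zero_add,
      Nat.cast_one, one_mul] at h
    · exact hP h
    · have : a (t + 1) = 0 := by
        have := ha (t + 1)
        rwa [Nat.choose_zero_succ, Nat.le_zero] at this
      rw [this, Nat.cast_zero, zero_mul]
  · have hn : 2 ≤ n := by
      by_contra! hn
      rw [Nat.choose_eq_zero_of_lt hn] at hN
      omega
    obtain ⟨l, rfl⟩ : ∃ l, n = l + 2 := ⟨n - 2, by omega⟩
    have hNpos' : (0 : ℝ) < N := Nat.cast_pos.2 hNpos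
    have htail := norm_sum_Ico_mul_le hNpos ha (c := 3)
      (f := fun t => ∏ i ∈ Finset.range (l + 2 - t), (z - (i : ℂ)))
      (norm_nonneg (∏ i ∈ Finset.range (l + 2), (z - (i : ℂ)))) three_pos (l + 2 + 1)
      fun t ht _ => by
        rw [Finset.mem_Ico] at ht
        have := norm_prod_range_sub_mul_pow_le (z := z) (r := √2 * N) (by positivity)
          (Nat.sub_le (l + 2) t) fun i _ hi => (hfar i hi).le
        rwa [show l + 2 - (l + 2 - t) = t by omega] at this
    obtain ⟨w, hw⟩ : ∃ w : ℂ, w = z - ((l + 1 : ℕ) : ℂ) := ⟨_, rfl⟩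
    have hw1 : w + 1 = z - (l : ℂ) := by rw [hw]; push_cast; ring
    have hlead := lt_norm_leading_terms hNpos (ha 2) (hw ▸ hfar (l + 1) (by omega))
      (hw1 ▸ hfar l (by omega))
    have hprod : ∏ i ∈ Finset.range (l + 2), (z - (i : ℂ)) =
        (∏ i ∈ Finset.range l, (z - (i : ℂ))) * ((w + 1) * w) := by
      rw [Finset.prod_range_succ, Finset.prod_range_succ, hw1, hw, mul_assoc]
    have hsum : (∏ i ∈ Finset.range l, (z - (i : ℂ))) * ((w + 1) * w + N * (w + 1) + a 2) =
        -∑ t ∈ Finset.Ico 3 (l + 2 + 1),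
          (a t : ℂ) * ∏ i ∈ Finset.range (l + 2 - t), (z - (i : ℂ)) := by
      rw [← Finset.sum_range_add_sum_Ico _ (show 3 ≤ l + 2 + 1 by omega), Finset.sum_range_succ,
        Finset.sum_range_succ, Finset.sum_range_one, ha0, ha1, Nat.sub_zero, Nat.add_sub_cancel,
        show l + 2 - 1 = l + 1 by omega, hprod, Finset.prod_range_succ, ← hw1] at h
      push_cast at h
      linear_combination h
    rw [← norm_neg, ← hsum, hprod, norm_mul, norm_mul] at htail
    have hl : 0 < ‖∏ i ∈ Finset.range l, (z - (i : ℂ))‖ := by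
      rw [hprod] at hP
      exact norm_pos_iff.2 (left_ne_zero_of_mul hP)
    have hconst : (√2)⁻¹ ^ 3 * ((3 : ℕ) + 1) / ((3 : ℕ).factorial * (3 : ℕ) : ℝ) =
        (√2)⁻¹ ^ 3 * (2 / 9) := by
      norm_num [Nat.factorial]
      ring
    rw [hconst] at htail
    nlinarith [mul_lt_mul_of_pos_left hlead hl]

end FallingFactorialExpansions

/-! ### Chromatic roots -/

section ChromaticRoots

variable {V : Type*} [Fintype V] (G : SimpleGraph V)

theorem sum_falling_eq_zero_of_mem_chromaticRoots {z : ℂ} (hz : z ∈ G.chromaticRoots) :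
    ∑ t ∈ Finset.range (Fintype.card V + 1), (G.stableCount t : ℂ) *
      ∏ i ∈ Finset.range (Fintype.card V - t), (z - (i : ℂ)) = 0 := by
  have hdesc : ∀ j, Polynomial.aeval z (descPochhammer ℤ j) =
      ∏ i ∈ Finset.range j, (z - (i : ℂ)) := fun j => by
    rw [← descPochhammer_eval_eq_prod_range, ← descPochhammer_map (algebraMap ℤ ℂ),
      Polynomial.eval_map_algebraMap]
  have h : Polynomial.aeval z G.chromaticPolynomial = 0 := hz
  rw [chromaticPolynomial_eq_sum_stableCount, map_sum] at h
  simpa only [map_mul, map_natCast, hdesc] using h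

end ChromaticRoots

end SimpleGraph

theorem theorem2p7 {V : Type*} [Fintype V] (G : SimpleGraph V) (k n m : ℕ)
    (hk : G.chromaticNumber = (k : ℕ∞))
    (hn : Fintype.card V = n)
    (hm : G.edgeSet.ncard = m) :
    (G.chromaticRoots ⊆
      {z : ℂ | ∃ i : ℕ, i < k ∧ z = (i : ℂ)} ∪
        ((⋃ j ∈ {j : ℕ | k ≤ j ∧ j + 2 ≤ n},
            Metric.closedBall (j : ℂ) (√2 * ((n.choose 2 : ℝ) - (m : ℝ)))) ∪
          Metric.closedBall ((n : ℂ) - 1 - (n.choose 2 : ℂ) + (m : ℂ))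
            (√2 * ((n.choose 2 : ℝ) - (m : ℝ))))) ∧
    (∀ z ∈ G.chromaticRoots,
      ‖z‖ ≤ (n : ℝ) - 1 + √2 * ((n.choose 2 : ℝ) - (m : ℝ))) := by
  subst hn
  obtain ⟨N, hN⟩ : ∃ N, N = Gᶜ.edgeSet.ncard := ⟨_, rfl⟩
  have hcount := G.ncard_edgeSet_add_ncard_edgeSet_compl
  rw [hm, ← hN] at hcount
  have hreal : (((Fintype.card V).choose 2 : ℕ) : ℝ) - m = N := by
    rw [← hcount]; push_cast; ring
  have hcenter : (Fintype.card V : ℂ) - 1 - ((Fintype.card V).choose 2 : ℂ) + m =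
      Fintype.card V - 1 - N := by
    rw [← hcount]; push_cast; ring
  have ha1 : G.stableCount 1 = N := hN ▸ G.stableCount_one
  have ha : ∀ t, G.stableCount t ≤ N.choose t := hN ▸ G.stableCount_le_choose
  rw [hreal, hcenter]
  refine ⟨fun z hz => ?_, fun z hz => ?_⟩
  · have hsum := G.sum_falling_eq_zero_of_mem_chromaticRoots hz
    by_contra hout
    simp only [Set.mem_union, Set.mem_iUnion, Metric.mem_closedBall, not_or, dist_eq_norm,
      Set.mem_ofPred_eq, not_exists, not_and, not_le, exists_prop] at hout
    obtain ⟨h1, h2, h3⟩ := hout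
    refine h3.not_ge (SimpleGraph.norm_sub_le_of_sum_falling_eq_zero G.stableCount_zero ha1 ha
      (fun t ht => ?_) ?_ h1 (fun i hi hi' => h2 i ⟨hi, hi'⟩) hsum)
    · have := G.chromaticNumber_le_of_stableCount_ne_zero ht
      rw [hk] at this
      exact_mod_cast this
    -- The graph without vertices has chromatic polynomial `1`.
    · rw [Nat.pos_iff_ne_zero]
      intro h0
      simp [h0, G.stableCount_zero] at hsum
  · exact SimpleGraph.norm_le_of_sum_falling_eq_zero G.stableCount_zero ha1 ha (by omega)
      (G.sum_falling_eq_zero_of_mem_chromaticRoots hz)
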